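/- Theorem (Generalized adiabatic theorem). Let $\mathcal H$ be a complex Hilbert space, let $T>0$, write $\|F\|_{\infty,T}=\sup_{s\in[0,T]}\|F(s)\|\in[0,\infty]$ (operator norm), let a dot denote the derivative on $[0,T]$ (one-sided at the end points), and let $\mathcal T\exp\bigl(-\mathrm i\int_0^t\mathrm ds\,K(s)\bigr)$ denote the time-ordered exponential (the sum of the Dyson series) generated by $K$. Let $H_0(t)=\sum_{\ell=1}^m E_\ell(t)P_\ell(t)$ for every $t\in[0,T]$, where $E_\ell(t)\in\mathbb R$, $P_\ell(t)=P_\ell(t)^\dagger$, $P_k(t)P_\ell(t)=\delta_{k\ell}P_\ell(t)$, $\sum_\ell P_\ell(t)=1$, the functions $E_\ell$ are $C^1$ and $P_\ell$ are $C^2$ (in operator norm) on $[0,T]$, and $E_k(t)\neq E_\ell(t)$ for all $k\ne\ell$, $t\in[0,T]$. Put $$A=\sum_{\ell}\frac{\mathrm i}{2}[\dot P_\ell,P_\ell],\qquad \eta=\min_{k\ne\ell}\min_{t\in[0,T]}|E_k(t)-E_\ell(t)|,\qquad \eta'=\max_{k\ne\ell}\max_{t\in[0,T]}|\dot E_k(t)-\dot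 E_\ell(t)|$$ (with $\eta=\infty$, $1/\eta=0$, $\eta'=0$, and right-hand side of the bound below equal to $0$, if there is only one level). For every $\kappa>0$ let $t\in[0,T]\mapsto H_\kappa(t)$ be an integrable family of bounded self-adjoint operators, and let $U_\kappa(t)=\mathcal T\exp\bigl(-\mathrm i\int_0^t\mathrm ds\,H_\kappa(s)\bigr)$. Assume that $\frac1\kappa H_\kappa(t)\to H_0(t)$ in norm as $\kappa\to+\infty$ for every $t\in[0,T]$, that $G_\kappa=H_\kappa-\kappa H_0$ is differentiable on $[0,T]$ for every $\kappa>0$, and that $\|G_\kappa\|_{\infty,T}$ and $\|\dot G_\kappa\|_{\infty,T}$ are both $o(\sqrt\kappa)$ as $\kappa\to+\infty$. Let $G_{\kappa,Z}(t)=\sum_\ell P_\ell(t)G_\kappa(t)P_\ell(t)$ and $$V_\kappa(t)=\mathcal T\exp\Bigl(-\mathrm i\int_0^t\mathrm ds\,[\kappa H_0(s)+G_{\kappa,Z}(s)+A(s)]\Bigr).$$ Then $U_\kappa(t)-V_\kappa(t)\to0$ in norm as $\kappa\to+\infty$, uniformly for $t\in[0,T]$, and for all $\kappa>0$ and $t\in[0,T]$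 $$\|U_\kappa(t)-V_\kappa(t)\|\le\frac{\sqrt m}{\kappa\eta}\bigl(1+T\|A\|_{\infty,T}+2T\|G_\kappa\|_{\infty,T}\bigr)\Bigl[\Bigl(2+\frac{\eta'}{\eta}T\Bigr)\bigl(\|A\|_{\infty,T}+\|G_\kappa\|_{\infty,T}\bigr)+T\bigl(\|\dot A\|_{\infty,T}+\|\dot G_\kappa\|_{\infty,T}+2\|A\|_{\infty,T}\|G_\kappa\|_{\infty,T}\bigr)\Bigr].$$ In particular (strong-coupling limit with time-dependent Hamiltonians), if $H_1(t)$ is bounded and self-adjoint for $t\in[0,T]$ and $H_1$ is differentiable on $[0,T]$ with $\|\dot H_1\|_{\infty,T}<\infty$, then the same uniform convergence and, for all $\kappa>0$ and $t\in[0,T]$, the same bound hold for $H_\kappa=\kappa H_0+H_1$, with $G_\kappa$ replaced by $H_1$. -/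

import Mathlib

noncomputable section

namespace GenAdiabatic

open Set
open scoped ENNReal

variable {𝓗 : Type*} [NormedAddCommGroup 𝓗] [InnerProductSpace ℂ 𝓗] [CompleteSpace 𝓗]

/-- The terms of the Dyson series of `H`:
`D₀(t) = 1` and `Dₙ₊₁(t) = -i ∫₀ᵗ H(s) Dₙ(s) ds`. -/
def dyson (H : ℝ → 𝓗 →L[ℂ] 𝓗) : ℕ → ℝ → 𝓗 →L[ℂ] 𝓗
  | 0, _ => 1
  | n + 1, t => (-Complex.I) • ∫ s in (0 : ℝ)..t, H s * dyson H n s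

/-- The time-ordered exponential `𝒯 exp(-i ∫₀ᵗ H(s) ds)`, as the sum of the Dyson series. -/
def timeOrderedExp (H : ℝ → 𝓗 →L[ℂ] 𝓗) (t : ℝ) : 𝓗 →L[ℂ] 𝓗 :=
  ∑' n, dyson H n t

/-- `‖F‖_{∞,T} = sup_{s ∈ [0,T]} ‖F(s)‖`, with value `∞` when `F` is unbounded on `[0,T]`. -/
def supNorm {X : Type*} [NormedAddCommGroup X] (T : ℝ) (F : ℝ → X) : ℝ≥0∞ :=
  ⨆ s ∈ Icc (0 : ℝ) T, ‖F s‖ₑ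

/-- The time derivative on `[0,T]` (one-sided at the end points). -/
def timeDeriv {X : Type*} [NormedAddCommGroup X] [NormedSpace ℝ X] (T : ℝ) (F : ℝ → X) (t : ℝ) :
    X :=
  derivWithin F (Icc (0 : ℝ) T) t

/-- `H₀(t) = ∑ₗ Eₗ(t) Pₗ(t)` is a finite spectral representation for every `t ∈ [0,T]`, with `C¹`
eigenvalues, `C²` spectral projections and no level crossings. -/
structure IsAdiabatic {m : ℕ} (T : ℝ) (H₀ : ℝ → 𝓗 →L[ℂ] 𝓗) (E : Fin m → ℝ → ℝ)
    (P : Fin m → ℝ → 𝓗 →L[ℂ] 𝓗) : Prop where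
  spectral : ∀ t ∈ Icc (0 : ℝ) T, H₀ t = ∑ l, (E l t : ℂ) • P l t
  selfAdjoint : ∀ l, ∀ t ∈ Icc (0 : ℝ) T, IsSelfAdjoint (P l t)
  orthogonal : ∀ k l, ∀ t ∈ Icc (0 : ℝ) T, P k t * P l t = if k = l then P l t else 0
  complete : ∀ t ∈ Icc (0 : ℝ) T, ∑ l, P l t = 1
  contDiff_E : ∀ l, ContDiffOn ℝ 1 (E l) (Icc (0 : ℝ) T)
  contDiff_P : ∀ l, ContDiffOn ℝ 2 (P l) (Icc (0 : ℝ) T)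
  noCrossing : ∀ k l, k ≠ l → ∀ t ∈ Icc (0 : ℝ) T, 0 < |E k t - E l t|

/-- The minimal spectral gap `η = min_{k ≠ l} min_{t ∈ [0,T]} |Eₖ(t) - Eₗ(t)|`
(`∞` if there is only one level). -/
def minGap {m : ℕ} (T : ℝ) (E : Fin m → ℝ → ℝ) : ℝ≥0∞ :=
  ⨅ (k : Fin m) (l : Fin m) (_ : k ≠ l), ⨅ t ∈ Icc (0 : ℝ) T, ‖E k t - E l t‖ₑ

/-- The maximal spectral slope `η' = max_{k ≠ l} max_{t ∈ [0,T]} |d/dt (Eₖ - Eₗ)(t)|`. -/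
def maxSlope {m : ℕ} (T : ℝ) (E : Fin m → ℝ → ℝ) : ℝ≥0∞ :=
  ⨆ (k : Fin m) (l : Fin m) (_ : k ≠ l), supNorm T (timeDeriv T (fun t => E k t - E l t))

/-- The adiabatic connection `A(t) = ∑ₗ (i/2) [Ṗₗ(t), Pₗ(t)]`. -/
def connection {m : ℕ} (T : ℝ) (P : Fin m → ℝ → 𝓗 →L[ℂ] 𝓗) (t : ℝ) : 𝓗 →L[ℂ] 𝓗 :=
  ∑ l, (Complex.I / 2) • (timeDeriv T (P l) t * P l t - P l t * timeDeriv T (P l) t)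

/-- The Zeno Hamiltonian `G_Z(t) = ∑ₗ Pₗ(t) G(t) Pₗ(t)`. -/
def zeno {m : ℕ} (P : Fin m → ℝ → 𝓗 →L[ℂ] 𝓗) (G : ℝ → 𝓗 →L[ℂ] 𝓗) (t : ℝ) : 𝓗 →L[ℂ] 𝓗 :=
  ∑ l, P l t * G t * P l t

/-- `G_κ(t) = H_κ(t) - κ H₀(t)`. -/
def remainder (H : ℝ → ℝ → 𝓗 →L[ℂ] 𝓗) (H₀ : ℝ → 𝓗 →L[ℂ] 𝓗) (κ t : ℝ) : 𝓗 →L[ℂ] 𝓗 :=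
  H κ t - (κ : ℂ) • H₀ t

/-- The evolution generated by `κ H₀ + G_Z + A`. -/
def adiabaticEvolution {m : ℕ} (T : ℝ) (H₀ : ℝ → 𝓗 →L[ℂ] 𝓗) (P : Fin m → ℝ → 𝓗 →L[ℂ] 𝓗)
    (G : ℝ → 𝓗 →L[ℂ] 𝓗) (κ : ℝ) : ℝ → 𝓗 →L[ℂ] 𝓗 :=
  timeOrderedExp fun s => (κ : ℂ) • H₀ s + zeno P G s + connection T P s

/-- The error bound
`√m / (κ η) (1 + T‖A‖ + 2T‖G‖) [(2 + (η'/η) T)(‖A‖ + ‖G‖) + T(‖Ȧ‖ + ‖Ġ‖ + 2‖A‖‖G‖)]`,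
all norms being `‖·‖_{∞,T}`. -/
def errorBound {m : ℕ} (T : ℝ) (E : Fin m → ℝ → ℝ) (P : Fin m → ℝ → 𝓗 →L[ℂ] 𝓗)
    (G : ℝ → 𝓗 →L[ℂ] 𝓗) (κ : ℝ) : ℝ≥0∞ :=
  ENNReal.ofReal (Real.sqrt m) / (ENNReal.ofReal κ * minGap T E)
    * (1 + ENNReal.ofReal T * supNorm T (connection T P) + 2 * ENNReal.ofReal T * supNorm T G)
    * ((2 + maxSlope T E / minGap T E * ENNReal.ofReal T)
          * (supNorm T (connection T P) + supNorm T G)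
        + ENNReal.ofReal T
          * (supNorm T (timeDeriv T (connection T P)) + supNorm T (timeDeriv T G)
              + 2 * supNorm T (connection T P) * supNorm T G))

end GenAdiabatic

end

noncomputable section

namespace GenAdiabatic

open Set
open scoped ENNReal

section

variable {𝓗 : Type*} [NormedAddCommGroup 𝓗] [InnerProductSpace ℂ 𝓗]

/-! ### The Dyson series -/

/-! Write `G` for the perturbation, `Z` for its Zeno part, `K = κ H₀ + Z + A`, and let `U`, `V` be
the evolutions generated by `κ H₀ + G` and `K`. The two generators differ by `G - A - Z`, which is
not small but is purely off-diagonal with respect to the `Pₗ`, because `A` has no diagonal blocks.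
As the gaps do not close, it is a commutator `[H₀, Y]` with `Y = ∑ₖₗ (Eₖ - Eₗ)⁻¹ Pₖ (G - A) Pₗ` over
`k ≠ l` (`commutator_blockSum`).

Dress the comparison with `C = 1 + κ⁻¹ Y`. In the derivative of `V⋆ C U` the term `[H₀, Y]` produced
by `κ H₀` cancels the difference of the generators exactly, and only `κ⁻¹` times bounded quantities
remains. Integrating, and paying `‖C - 1‖ = O(κ⁻¹)` at both end points, bounds `U - V`
(`norm_timeOrderedExp_sub_le`). This is an integration by parts over the fast phases.

Differentiating `Y` is clean because `A` transports the projections: `Ṗₗ = -i [A, Pₗ]`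
(`commutator_connection`, `hasDerivWithinAt_blockSum`). The factor `√m` comes from estimating `Y`
row by row (`norm_blockSum_le`). The resulting bound is quadratic in the size of `G` and carries
`κ⁻¹`, so growth `o(√κ)` of `G` and `Ġ` gives convergence (`tendsto_errorBound`). -/

lemma dyson_congr {T : ℝ} {H K : ℝ → 𝓗 →L[ℂ] 𝓗} (h : EqOn H K (Icc 0 T)) (n : ℕ) :
    EqOn (dyson H n) (dyson K n) (Icc 0 T) := by
  induction n with
  | zero => intro t _; rfl
  | succ n ih =>
    intro t ht
    simp only [dyson]
    congr 1
    refine intervalIntegral.integral_congr fun s hs => ?_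
    rw [uIcc_of_le ht.1] at hs
    have hs' : s ∈ Icc 0 T := ⟨hs.1, hs.2.trans ht.2⟩
    simp only [h hs', ih hs']

lemma timeOrderedExp_congr {T : ℝ} {H K : ℝ → 𝓗 →L[ℂ] 𝓗} (h : EqOn H K (Icc 0 T)) :
    EqOn (timeOrderedExp H) (timeOrderedExp K) (Icc 0 T) := fun _ ht =>
  tsum_congr fun n => dyson_congr h n ht

lemma timeOrderedExp_zero (H : ℝ → 𝓗 →L[ℂ] 𝓗) : timeOrderedExp H 0 = 1 := by
  rw [timeOrderedExp, tsum_eq_single 0]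
  · rfl
  · intro n hn
    obtain ⟨k, rfl⟩ := Nat.exists_eq_succ_of_ne_zero hn
    simp [dyson]

variable [CompleteSpace 𝓗]

lemma continuous_dyson {H : ℝ → 𝓗 →L[ℂ] 𝓗} (hH : Continuous H) (n : ℕ) :
    Continuous (dyson H n) := by
  induction n with
  | zero => exact continuous_const
  | succ n ih =>
    have h := intervalIntegral.continuous_primitive (μ := MeasureTheory.volume)
      (fun a b => (hH.mul ih).intervalIntegrable a b) 0
    exact h.const_smul (-Complex.I)

lemma hasDerivAt_dyson_succ {H : ℝ → 𝓗 →L[ℂ] 𝓗} (hH : Continuous H) (n : ℕ) (t : ℝ) :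
    HasDerivAt (dyson H (n + 1)) ((-Complex.I) • (H t * dyson H n t)) t :=
  ((hH.mul (continuous_dyson hH n)).integral_hasStrictDerivAt 0 t).hasDerivAt.const_smul
    (-Complex.I)

/-- Each iterated integral turns `|s| ^ n / n!` into `|t| ^ (n + 1) / (n + 1)!`. This is what makes
the Dyson series converge like an exponential. -/
lemma norm_dyson_le {H : ℝ → 𝓗 →L[ℂ] 𝓗} {M : ℝ} (hM : ∀ s, ‖H s‖ ≤ M)
    (n : ℕ) (t : ℝ) : ‖dyson H n t‖ ≤ M ^ n * |t| ^ n / n.factorial := by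
  have hM0 : 0 ≤ M := (norm_nonneg _).trans (hM 0)
  induction n generalizing t with
  | zero => 
    simp only [dyson, pow_zero, mul_one, Nat.factorial_zero, Nat.cast_one, div_one]
    exact ContinuousLinearMap.norm_id_le
  | succ n ih =>
    have hint : MeasureTheory.IntegrableOn (fun s : ℝ => M ^ (n + 1) / n.factorial * |s - 0| ^ n)
        (uIoc 0 t) := by
      refine (Continuous.integrableOn_uIcc ?_).mono_set uIoc_subset_uIcc
      fun_prop
    calc ‖dyson H (n + 1) t‖ = ‖∫ s in (0 : ℝ)..t, H s * dyson H n s‖ := by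
          simp [dyson, norm_smul]
      _ ≤ ∫ s in uIoc 0 t, ‖H s * dyson H n s‖ :=
          intervalIntegral.norm_integral_le_integral_norm_uIoc
      _ ≤ ∫ s in uIoc 0 t, M ^ (n + 1) / n.factorial * |s - 0| ^ n := by
          refine MeasureTheory.integral_mono_of_nonneg (.of_forall fun _ => norm_nonneg _) hint
            (.of_forall fun s => ?_)
          calc ‖H s * dyson H n s‖ ≤ ‖H s‖ * ‖dyson H n s‖ := norm_mul_le _ _
            _ ≤ M * (M ^ n * |s| ^ n / n.factorial) := by gcongr; exacts [hM s, ih s]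
            _ = M ^ (n + 1) / n.factorial * |s - 0| ^ n := by rw [sub_zero]; ring
      _ = _ := by
          rw [MeasureTheory.integral_const_mul, integral_pow_abs_sub_uIoc, sub_zero,
            Nat.factorial_succ]
          push_cast
          field_simp

lemma summable_dyson {H : ℝ → 𝓗 →L[ℂ] 𝓗} {M : ℝ} (hM : ∀ s, ‖H s‖ ≤ M) (t : ℝ) :
    Summable fun n => dyson H n t := by
  refine Summable.of_norm_bounded (g := fun n : ℕ => (M * |t|) ^ n / n.factorial)
    (Real.summable_pow_div_factorial _) fun n => ?_
  rw [mul_pow]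
  exact norm_dyson_le hM n t

lemma hasDerivAt_timeOrderedExp {H : ℝ → 𝓗 →L[ℂ] 𝓗} (hH : Continuous H) {M : ℝ}
    (hM : ∀ s, ‖H s‖ ≤ M) (t : ℝ) :
    HasDerivAt (timeOrderedExp H) ((-Complex.I) • (H t * timeOrderedExp H t)) t := by
  have hM0 : 0 ≤ M := (norm_nonneg _).trans (hM 0)
  -- An interval containing both `0`, where summability is checked, and `t`; on it the termwise
  -- derivatives have a uniform summable majorant.
  set R := |t| + 1
  have hd : HasDerivAt (fun s => ∑' n, dyson H (n + 1) s)
      (∑' n, (-Complex.I) • (H t * dyson H n t)) t := by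
    have h0 : (0 : ℝ) ∈ Ioo (-R) R := ⟨by simp only [R]; linarith [abs_nonneg t], by positivity⟩
    have ht : t ∈ Ioo (-R) R := abs_lt.1 (lt_add_one |t|)
    have hs0 : Summable fun n => dyson H (n + 1) 0 :=
      (summable_nat_add_iff (f := fun n => dyson H n 0) 1).2 (summable_dyson hM 0)
    refine hasDerivAt_tsum_of_isPreconnected (g := fun n => dyson H (n + 1))
      (g' := fun n s => (-Complex.I) • (H s * dyson H n s)) (u := fun n : ℕ => M * ((M * R) ^ n / n.factorial)) (t := Ioo (-R) R) (y₀ := 0)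
      ((Real.summable_pow_div_factorial _).mul_left M) isOpen_Ioo isPreconnected_Ioo
      (fun n s _ => hasDerivAt_dyson_succ hH n s) (fun n s hs => ?_)
      h0 hs0 ht
    · calc ‖(-Complex.I) • (H s * dyson H n s)‖ = ‖H s * dyson H n s‖ := by simp [norm_smul]
        _ ≤ ‖H s‖ * ‖dyson H n s‖ := norm_mul_le _ _
        _ ≤ M * (M ^ n * |s| ^ n / n.factorial) := by
          gcongr; exacts [hM s, norm_dyson_le hM n s]
        _ ≤ M * ((M * R) ^ n / n.factorial) := by
          rw [mul_pow]; gcongr; exact (abs_lt.2 hs).le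
  have hsum : timeOrderedExp H = fun s => 1 + ∑' n, dyson H (n + 1) s := by
    funext s
    exact (summable_dyson hM s).tsum_eq_zero_add
  have hval : ∑' n, (-Complex.I) • (H t * dyson H n t)
      = (-Complex.I) • (H t * timeOrderedExp H t) := by
    rw [tsum_const_smul'', timeOrderedExp, (summable_dyson hM t).tsum_mul_left]
  rw [← hval, hsum]
  exact hd.const_add 1

lemma hasDerivWithinAt_timeOrderedExp {T : ℝ} (hT : 0 ≤ T) {H : ℝ → 𝓗 →L[ℂ] 𝓗}
    (hH : ContinuousOn H (Icc 0 T)) {t : ℝ} (ht : t ∈ Icc 0 T) :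
    HasDerivWithinAt (timeOrderedExp H) ((-Complex.I) • (H t * timeOrderedExp H t))
      (Icc 0 T) t := by
  obtain ⟨M, hM⟩ := isCompact_Icc.exists_bound_of_continuousOn hH
  -- The series on `[0,T]` sees only the values of `H` there, so `H` may be replaced by its constant
  -- extension, which is continuous and bounded on all of `ℝ`.
  set K : ℝ → 𝓗 →L[ℂ] 𝓗 := IccExtend hT ((Icc 0 T).domRestrict H)
  have hK : EqOn H K (Icc 0 T) := fun s hs => (IccExtend_of_mem hT ((Icc 0 T).domRestrict H) hs).symm
  have hKc : Continuous K := (continuousOn_iff_continuous_domRestrict.1 hH).Icc_extend'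
  have hKM : ∀ s, ‖K s‖ ≤ M := fun s => hM _ (projIcc 0 T hT s).2
  have := (hasDerivAt_timeOrderedExp hKc hKM t).hasDerivWithinAt (s := Icc 0 T)
  rw [hK ht, timeOrderedExp_congr hK ht]
  exact this.congr (timeOrderedExp_congr hK) (timeOrderedExp_congr hK ht)

/-! ### Unitarity -/

lemma star_mul_timeOrderedExp {T : ℝ} (hT : 0 ≤ T) {H : ℝ → 𝓗 →L[ℂ] 𝓗}
    (hH : ContinuousOn H (Icc 0 T)) (hsa : ∀ t ∈ Icc 0 T, IsSelfAdjoint (H t))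
    {t : ℝ} (ht : t ∈ Icc 0 T) :
    star (timeOrderedExp H t) * timeOrderedExp H t = 1 := by
  have hd : ∀ s ∈ Icc 0 T, HasDerivWithinAt
      (fun s => star (timeOrderedExp H s) * timeOrderedExp H s) 0 (Icc 0 T) s := by
    intro s hs
    have h := hasDerivWithinAt_timeOrderedExp hT hH hs
    refine (h.star.mul h).congr_deriv ?_
    simp [(hsa s hs).star_eq, mul_assoc]
  have := (convex_Icc 0 T).norm_image_sub_le_of_norm_hasDerivWithin_le (C := 0) hd (by simp)
    (left_mem_Icc.2 hT) ht
  simpa [timeOrderedExp_zero, sub_eq_zero] using this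

/-- In infinite dimension an isometry need not be unitary, so this side needs its own argument: `Z =
U U⋆ - 1` solves the linear equation `Z' = -i [H, Z]` with `Z(0) = 0`, and Grönwall forces `Z = 0`.
-/
lemma timeOrderedExp_mul_star {T : ℝ} (hT : 0 ≤ T) {H : ℝ → 𝓗 →L[ℂ] 𝓗}
    (hH : ContinuousOn H (Icc 0 T)) (hsa : ∀ t ∈ Icc 0 T, IsSelfAdjoint (H t))
    {t : ℝ} (ht : t ∈ Icc 0 T) :
    timeOrderedExp H t * star (timeOrderedExp H t) = 1 := by
  obtain ⟨M, hM⟩ := isCompact_Icc.exists_bound_of_continuousOn hH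
  set Z : ℝ → 𝓗 →L[ℂ] 𝓗 := fun s => timeOrderedExp H s * star (timeOrderedExp H s) - 1
  have hd : ∀ s ∈ Icc 0 T, HasDerivWithinAt Z
      ((-Complex.I) • (H s * Z s - Z s * H s)) (Icc 0 T) s := by
    intro s hs
    have h := hasDerivWithinAt_timeOrderedExp hT hH hs
    refine ((h.mul h.star).sub_const 1).congr_deriv ?_
    simp [(hsa s hs).star_eq, mul_assoc, Z, mul_sub, sub_mul]
    module
  have := norm_le_gronwallBound_of_norm_deriv_right_le (f := Z) (δ := 0) (K := 2 * M) (ε := 0)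
    (a := 0) (b := T)
    (fun s hs => (hd s hs).continuousWithinAt)
    (fun s hs => (hd s (Ico_subset_Icc_self hs)).mono_of_mem_nhdsWithin
      (Icc_mem_nhdsGE_of_mem hs))
    (by simp [Z, timeOrderedExp_zero]) (fun s hs => ?_) t ht
  · simpa [gronwallBound_ε0, Z, sub_eq_zero] using this
  · have hs' := hM s (Ico_subset_Icc_self hs)
    calc ‖(-Complex.I) • (H s * Z s - Z s * H s)‖ = ‖H s * Z s - Z s * H s‖ := by
          rw [norm_smul]; simp
      _ ≤ ‖H s‖ * ‖Z s‖ + ‖Z s‖ * ‖H s‖ :=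
          (norm_sub_le _ _).trans (add_le_add (norm_mul_le _ _) (norm_mul_le _ _))
      _ ≤ M * ‖Z s‖ + ‖Z s‖ * M := by gcongr
      _ = 2 * M * ‖Z s‖ + 0 := by ring

lemma norm_le_one_of_star_mul_self {V : 𝓗 →L[ℂ] 𝓗} (h : star V * V = 1) : ‖V‖ ≤ 1 := by
  have h1 : ‖V‖ * ‖V‖ ≤ 1 := by
    rw [← CStarRing.norm_star_mul_self, h]
    exact ContinuousLinearMap.norm_id_le
  nlinarith [norm_nonneg V]

end

section

variable {𝓗 : Type*} [NormedAddCommGroup 𝓗] [InnerProductSpace ℂ 𝓗]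

/-- Summing `Dₗ Pₗ + Pₗ Dₗ = Dₗ` over `l` gives `∑ Dₗ Pₗ = -∑ Pₗ Dₗ`, so the symmetric form of the
connection collapses to either one-sided form. -/
lemma sum_commutator_eq {m : ℕ} {P D : Fin m → 𝓗 →L[ℂ] 𝓗}
    (hD : ∀ l, D l * P l + P l * D l = D l) (hD0 : ∑ l, D l = 0) :
    ∑ l, (Complex.I / 2) • (D l * P l - P l * D l) = Complex.I • ∑ l, D l * P l ∧
    ∑ l, (Complex.I / 2) • (D l * P l - P l * D l) = -(Complex.I • ∑ l, P l * D l) := by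
  have h : ∑ l, D l * P l + ∑ l, P l * D l = 0 := by
    rw [← Finset.sum_add_distrib, ← hD0]
    exact Finset.sum_congr rfl fun l _ => hD l
  rw [← Finset.smul_sum, Finset.sum_sub_distrib]
  constructor
  · rw [eq_neg_of_add_eq_zero_right h]; module
  · rw [eq_neg_of_add_eq_zero_left h]; module

variable [CompleteSpace 𝓗]

/-! ### Orthogonal resolutions of the identity -/

/-- A finite family of mutually orthogonal self-adjoint projections that sum up to `1`. -/
structure IsResolution {m : ℕ} (P : Fin m → 𝓗 →L[ℂ] 𝓗) : Prop where
  selfAdjoint : ∀ l, IsSelfAdjoint (P l)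
  orthogonal : ∀ k l, P k * P l = if k = l then P l else 0
  complete : ∑ l, P l = 1

/-- The operator `∑ₖₗ wₖₗ Pₖ X Pₗ`. -/
def blockSum {m : ℕ} (P : Fin m → 𝓗 →L[ℂ] 𝓗) (w : Fin m → Fin m → ℝ) (X : 𝓗 →L[ℂ] 𝓗) :
    𝓗 →L[ℂ] 𝓗 :=
  ∑ k, ∑ l, w k l • (P k * X * P l)

namespace IsResolution

variable {m : ℕ} {P : Fin m → 𝓗 →L[ℂ] 𝓗}

/-- Pythagoras: `‖Pₗ x‖² = ⟨x, Pₗ x⟩`, and the `Pₗ` sum to `1`. -/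
lemma sum_norm_sq (hP : IsResolution P) (x : 𝓗) : ∑ l, ‖P l x‖ ^ 2 = ‖x‖ ^ 2 := by
  have h : ∀ l, ((‖P l x‖ ^ 2 : ℝ) : ℂ) = inner ℂ x (P l x) := by
    intro l
    have hl : P l (P l x) = P l x := by
      have := hP.orthogonal l l
      rw [if_pos rfl] at this
      exact congrArg (fun B : 𝓗 →L[ℂ] 𝓗 => B x) this
    have hs := (hP.selfAdjoint l).isSymmetric x (P l x)
    simp only [ContinuousLinearMap.coe_coe] at hs
    rw [hl] at hs
    rw [← hs, inner_self_eq_norm_sq_to_K]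
    simp
  have h1 : (∑ l, P l) x = x := by rw [hP.complete]; rfl
  have : ((∑ l, ‖P l x‖ ^ 2 : ℝ) : ℂ) = ((‖x‖ ^ 2 : ℝ) : ℂ) := by
    rw [Complex.ofReal_sum, Finset.sum_congr rfl fun l _ => h l, ← inner_sum,
      ← sum_apply, h1, inner_self_eq_norm_sq_to_K]
    simp
  exact_mod_cast this

/-- If each row `Pₖ S` of `S` has norm at most `c`, then `‖S‖ ≤ √m c`. -/
lemma norm_le_sqrt_mul (hP : IsResolution P) {S : 𝓗 →L[ℂ] 𝓗} {c : ℝ} (hc : 0 ≤ c)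
    (h : ∀ k, ‖P k * S‖ ≤ c) : ‖S‖ ≤ Real.sqrt m * c := by
  refine S.opNorm_le_bound (by positivity) fun x => ?_
  refine (sq_le_sq₀ (norm_nonneg _) (by positivity)).1 ?_
  rw [← hP.sum_norm_sq]
  calc ∑ k, ‖P k (S x)‖ ^ 2 ≤ ∑ _k : Fin m, (c * ‖x‖) ^ 2 := by
        refine Finset.sum_le_sum fun k _ => ?_
        gcongr
        exact ((P k * S).le_opNorm x).trans (by gcongr; exact h k)
    _ = (Real.sqrt m * c * ‖x‖) ^ 2 := by
        rw [mul_assoc, mul_pow (Real.sqrt m), Real.sq_sqrt (Nat.cast_nonneg m)]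
        simp

lemma norm_proj_le (hP : IsResolution P) (l : Fin m) : ‖P l‖ ≤ 1 := by
  refine (P l).opNorm_le_bound zero_le_one fun x => ?_
  rw [one_mul]
  refine (sq_le_sq₀ (norm_nonneg _) (norm_nonneg _)).1 ?_
  rw [← hP.sum_norm_sq x]
  exact Finset.single_le_sum (f := fun l => ‖P l x‖ ^ 2) (fun _ _ => by positivity)
    (Finset.mem_univ l)

lemma mul_sum_eq (hP : IsResolution P) (k : Fin m) (B : Fin m → 𝓗 →L[ℂ] 𝓗) :
    P k * ∑ l, P l * B l = P k * B k := by
  simp [Finset.mul_sum, ← mul_assoc, hP.orthogonal]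

/-- A block-diagonal operator is bounded by its largest block. -/
lemma norm_sum_block_le (hP : IsResolution P) {B : Fin m → 𝓗 →L[ℂ] 𝓗} {c : ℝ} (hc : 0 ≤ c)
    (h : ∀ l, ‖B l‖ ≤ c) : ‖∑ l, P l * B l * P l‖ ≤ c := by
  refine ContinuousLinearMap.opNorm_le_bound _ hc fun x => ?_
  refine (sq_le_sq₀ (norm_nonneg _) (by positivity)).1 ?_
  rw [← hP.sum_norm_sq, mul_pow, ← hP.sum_norm_sq x, Finset.mul_sum]
  refine Finset.sum_le_sum fun k _ => ?_
  have hk : P k ((∑ l, P l * B l * P l) x) = P k (B k (P k x)) := by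
    have := hP.mul_sum_eq k fun l => B l * P l
    simp only [← mul_assoc] at this
    exact congrArg (fun B : 𝓗 →L[ℂ] 𝓗 => B x) this
  rw [hk, ← mul_pow]
  gcongr
  calc ‖P k (B k (P k x))‖ ≤ 1 * ‖B k (P k x)‖ := (P k).le_of_opNorm_le (hP.norm_proj_le k) _
    _ ≤ c * ‖P k x‖ := by rw [one_mul]; exact (B k).le_of_opNorm_le (h k) _

lemma norm_zeno_le (hP : IsResolution P) (G : 𝓗 →L[ℂ] 𝓗) : ‖∑ l, P l * G * P l‖ ≤ ‖G‖ :=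
  hP.norm_sum_block_le (norm_nonneg _) fun _ => le_rfl

lemma norm_sum_smul_le (hP : IsResolution P) {w : Fin m → ℝ} {c : ℝ} (hc : 0 ≤ c)
    (h : ∀ l, |w l| ≤ c) : ‖∑ l, w l • P l‖ ≤ c := by
  have h1 : ∑ l, w l • P l = ∑ l, P l * (w l • 1) * P l := by
    simp [hP.orthogonal]
  rw [h1]
  refine hP.norm_sum_block_le hc fun l => ?_
  calc ‖w l • (1 : 𝓗 →L[ℂ] 𝓗)‖ ≤ |w l| * 1 := by
        rw [norm_smul, Real.norm_eq_abs]
        gcongr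
        exact ContinuousLinearMap.norm_id_le
    _ ≤ c := by rw [mul_one]; exact h l

/-- The `k`-th row factors as `Pₖ X (∑ₗ wₖₗ Pₗ)`, whose last factor is diagonal and hence of norm at
most `c`. Combining the `m` orthogonal rows costs `√m`. -/
lemma norm_blockSum_le (hP : IsResolution P) {w : Fin m → Fin m → ℝ} {c : ℝ} (hc : 0 ≤ c)
    (h : ∀ k l, |w k l| ≤ c) (X : 𝓗 →L[ℂ] 𝓗) :
    ‖blockSum P w X‖ ≤ Real.sqrt m * c * ‖X‖ := by
  have hrow : ∀ k, P k * blockSum P w X = P k * X * ∑ l, w k l • P l := by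
    intro k
    have h1 : blockSum P w X = ∑ k, P k * (X * ∑ l, w k l • P l) := by
      simp [blockSum, Finset.mul_sum, mul_assoc]
    rw [h1, hP.mul_sum_eq, mul_assoc]
  rw [mul_assoc]
  refine hP.norm_le_sqrt_mul (by positivity) fun k => ?_
  rw [hrow]
  calc ‖P k * X * ∑ l, w k l • P l‖ ≤ ‖P k‖ * ‖X‖ * ‖∑ l, w k l • P l‖ :=
        (norm_mul_le _ _).trans (by gcongr; exact norm_mul_le _ _)
    _ ≤ 1 * ‖X‖ * c := by
        gcongr
        exacts [hP.norm_proj_le k, hP.norm_sum_smul_le hc (h k)]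
    _ = c * ‖X‖ := by ring

lemma sum_blocks (hP : IsResolution P) (X : 𝓗 →L[ℂ] 𝓗) : ∑ k, ∑ l, P k * X * P l = X := by
  simp [← Finset.mul_sum, ← Finset.sum_mul, hP.complete]

lemma sum_mul_blockSum (hP : IsResolution P) (e : Fin m → ℝ) (w : Fin m → Fin m → ℝ)
    (X : 𝓗 →L[ℂ] 𝓗) :
    (∑ l, e l • P l) * blockSum P w X = blockSum P (fun k l => e k * w k l) X := by
  simp only [blockSum, Finset.mul_sum, Finset.sum_mul, smul_mul_smul_comm, ← mul_assoc,
    hP.orthogonal, ite_mul, zero_mul, smul_ite, smul_zero]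
  conv_rhs => rw [Finset.sum_comm]
  rw [Finset.sum_comm]
  refine Finset.sum_congr rfl fun k _ => ?_
  rw [Finset.sum_comm]
  simp

lemma blockSum_mul_sum (hP : IsResolution P) (e : Fin m → ℝ) (w : Fin m → Fin m → ℝ)
    (X : 𝓗 →L[ℂ] 𝓗) :
    blockSum P w X * (∑ l, e l • P l) = blockSum P (fun k l => e l * w k l) X := by
  simp only [blockSum, Finset.mul_sum, Finset.sum_mul, smul_mul_smul_comm, mul_assoc,
    hP.orthogonal, mul_ite, mul_zero, smul_ite, smul_zero]
  rw [Finset.sum_comm]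
  refine Finset.sum_congr rfl fun k _ => ?_
  simp [mul_comm]

/-- The operator `Y = ∑ₖₗ (eₖ - eₗ)⁻¹ Pₖ X Pₗ` solves `[H, Y] = X - ∑ₗ Pₗ X Pₗ` for
`H = ∑ₗ eₗ Pₗ`. -/
lemma commutator_blockSum (hP : IsResolution P) {e : Fin m → ℝ} (he : ∀ k l, k ≠ l → e k ≠ e l)
    (X : 𝓗 →L[ℂ] 𝓗) :
    (∑ l, e l • P l) * blockSum P (fun k l => (e k - e l)⁻¹) X
      - blockSum P (fun k l => (e k - e l)⁻¹) X * (∑ l, e l • P l)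
      = X - ∑ l, P l * X * P l := by
  rw [hP.sum_mul_blockSum, hP.blockSum_mul_sum, eq_sub_iff_add_eq]
  conv_rhs => rw [← hP.sum_blocks X]
  simp only [blockSum, ← Finset.sum_sub_distrib, ← Finset.sum_add_distrib]
  refine Finset.sum_congr rfl fun k _ => ?_
  have hk : P k * X * P k = ∑ l, if k = l then P k * X * P l else 0 := by simp
  rw [hk, ← Finset.sum_add_distrib]
  refine Finset.sum_congr rfl fun l _ => ?_
  rw [← sub_smul, ← sub_mul]
  -- On the diagonal the weight is `0⁻¹ = 0`, so `Y` has no diagonal blocks and the subtracted term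
  -- supplies them.
  by_cases hkl : k = l
  · simp [hkl]
  · rw [mul_inv_cancel₀ (sub_ne_zero.2 (he k l hkl)), one_smul, if_neg hkl, add_zero]

/-! #### The adiabatic connection at a fixed time -/

variable {D : Fin m → 𝓗 →L[ℂ] 𝓗}

/-- The one-sided forms of `A` and orthogonality give `A Pₗ = i Dₗ Pₗ` and `Pₗ A = -i Pₗ Dₗ`; their
difference is `i Dₗ`. -/
lemma commutator_connection (hP : IsResolution P) (hD : ∀ l, D l * P l + P l * D l = D l)
    (hD0 : ∑ l, D l = 0) {A : 𝓗 →L[ℂ] 𝓗}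
    (hA : A = ∑ l, (Complex.I / 2) • (D l * P l - P l * D l)) (l : Fin m) :
    (-Complex.I) • (A * P l - P l * A) = D l := by
  obtain ⟨h1, h2⟩ := sum_commutator_eq hD hD0
  have e1 : A * P l = Complex.I • (D l * P l) := by
    rw [hA, h1, smul_mul_assoc, Finset.sum_mul]
    simp [mul_assoc, hP.orthogonal]
  have e2 : P l * A = -(Complex.I • (P l * D l)) := by
    rw [hA, h2, mul_neg, mul_smul_comm, hP.mul_sum_eq]
  rw [e1, e2, sub_neg_eq_add, ← smul_add, hD, smul_smul]
  simp

lemma diag_connection (hP : IsResolution P) (hD : ∀ l, D l * P l + P l * D l = D l)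
    (hD0 : ∑ l, D l = 0) {A : 𝓗 →L[ℂ] 𝓗}
    (hA : A = ∑ l, (Complex.I / 2) • (D l * P l - P l * D l)) (l : Fin m) :
    P l * A * P l = 0 := by
  obtain ⟨_, h2⟩ := sum_commutator_eq hD hD0
  have hl : P l * P l = P l := by simpa using hP.orthogonal l l
  -- Compressing `D P + P D = D` by `P` on both sides gives `2 P D P = P D P`.
  have e : P l * D l * P l = 0 := by
    have := congrArg (fun B => P l * B * P l) (hD l)
    simp only [mul_add, add_mul, mul_assoc, hl] at this
    rw [← mul_assoc (P l) (P l), hl] at this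
    simpa [mul_assoc] using this
  rw [hA, h2, mul_neg, mul_smul_comm, hP.mul_sum_eq, neg_mul, smul_mul_assoc, e]
  simp

end IsResolution

end

variable {𝓗 : Type*} [NormedAddCommGroup 𝓗] [InnerProductSpace ℂ 𝓗] [CompleteSpace 𝓗]

/-! ### The adiabatic data on `[0,T]` -/

namespace IsAdiabatic

variable {m : ℕ} {T : ℝ} {H₀ : ℝ → 𝓗 →L[ℂ] 𝓗} {E : Fin m → ℝ → ℝ} {P : Fin m → ℝ → 𝓗 →L[ℂ] 𝓗}

lemma isResolution (h : IsAdiabatic T H₀ E P) {t : ℝ} (ht : t ∈ Icc 0 T) :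
    IsResolution fun l => P l t :=
  ⟨fun l => h.selfAdjoint l t ht, fun k l => h.orthogonal k l t ht, h.complete t ht⟩

lemma hasDerivWithinAt_P (h : IsAdiabatic T H₀ E P) (l : Fin m) {t : ℝ} (ht : t ∈ Icc 0 T) :
    HasDerivWithinAt (P l) (timeDeriv T (P l) t) (Icc 0 T) t :=
  ((h.contDiff_P l).differentiableOn (by norm_num) t ht).hasDerivWithinAt

lemma differentiableOn_E (h : IsAdiabatic T H₀ E P) (l : Fin m) :
    DifferentiableOn ℝ (E l) (Icc 0 T) :=
  (h.contDiff_E l).differentiableOn (by norm_num)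

/-- The product rule applied to `Pₗ² = Pₗ`. -/
lemma timeDeriv_anticomm (h : IsAdiabatic T H₀ E P) (hT : 0 < T) {t : ℝ} (ht : t ∈ Icc 0 T)
    (l : Fin m) : timeDeriv T (P l) t * P l t + P l t * timeDeriv T (P l) t
      = timeDeriv T (P l) t := by
  have hd := h.hasDerivWithinAt_P l ht
  refine (uniqueDiffOn_Icc hT t ht).eq_deriv _ (hd.mul hd) (hd.congr (fun s hs => ?_) ?_)
  · simpa using h.orthogonal l l s hs
  · simpa using h.orthogonal l l t ht

lemma sum_timeDeriv (h : IsAdiabatic T H₀ E P) (hT : 0 < T) {t : ℝ} (ht : t ∈ Icc 0 T) :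
    ∑ l, timeDeriv T (P l) t = 0 := by
  have hd := HasDerivWithinAt.fun_sum (u := Finset.univ) fun l _ => h.hasDerivWithinAt_P l ht
  exact (uniqueDiffOn_Icc hT t ht).eq_deriv _ hd
    ((hasDerivWithinAt_const t (Icc 0 T) (1 : 𝓗 →L[ℂ] 𝓗)).congr
      (fun s hs => h.complete s hs) (h.complete t ht))

lemma isSelfAdjoint_timeDeriv (h : IsAdiabatic T H₀ E P) (hT : 0 < T) {t : ℝ}
    (ht : t ∈ Icc 0 T) (l : Fin m) : IsSelfAdjoint (timeDeriv T (P l) t) := by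
  have hd := h.hasDerivWithinAt_P l ht
  exact (uniqueDiffOn_Icc hT t ht).eq_deriv _ hd.star
    (hd.congr (fun s hs => h.selfAdjoint l s hs) (h.selfAdjoint l t ht))

/-- The projections are parallel transported by the connection. -/
lemma timeDeriv_P (h : IsAdiabatic T H₀ E P) (hT : 0 < T) {t : ℝ} (ht : t ∈ Icc 0 T)
    (l : Fin m) : (-Complex.I) • (connection T P t * P l t - P l t * connection T P t)
      = timeDeriv T (P l) t :=
  (h.isResolution ht).commutator_connection (h.timeDeriv_anticomm hT ht) (h.sum_timeDeriv hT ht)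
    rfl l

lemma diag_connection (h : IsAdiabatic T H₀ E P) (hT : 0 < T) {t : ℝ} (ht : t ∈ Icc 0 T)
    (l : Fin m) : P l t * connection T P t * P l t = 0 :=
  (h.isResolution ht).diag_connection (h.timeDeriv_anticomm hT ht) (h.sum_timeDeriv hT ht) rfl l

lemma contDiffOn_connection (h : IsAdiabatic T H₀ E P) (hT : 0 < T) :
    ContDiffOn ℝ 1 (connection T P) (Icc 0 T) := by
  have hP : ∀ l, ContDiffOn ℝ 1 (P l) (Icc 0 T) := fun l => (h.contDiff_P l).of_le (by norm_num)
  have hD : ∀ l, ContDiffOn ℝ 1 (timeDeriv T (P l)) (Icc 0 T) := fun l =>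
    (h.contDiff_P l).derivWithin (uniqueDiffOn_Icc hT) (by norm_num)
  refine ContDiffOn.sum fun l _ => ?_
  exact (((hD l).mul (hP l)).sub ((hP l).mul (hD l))).const_smul (Complex.I / 2)

lemma isSelfAdjoint_connection (h : IsAdiabatic T H₀ E P) (hT : 0 < T) {t : ℝ}
    (ht : t ∈ Icc 0 T) : IsSelfAdjoint (connection T P t) := by
  refine isSelfAdjoint_sum _ fun l _ => ?_
  have h1 := (h.isSelfAdjoint_timeDeriv hT ht l).star_eq
  have h2 := (h.selfAdjoint l t ht).star_eq
  simp only [IsSelfAdjoint, star_smul, star_sub, star_mul, h1, h2]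
  rw [← neg_sub, smul_neg, ← neg_smul]
  simp [neg_div]

lemma spectral_real (h : IsAdiabatic T H₀ E P) {t : ℝ} (ht : t ∈ Icc 0 T) :
    H₀ t = ∑ l, E l t • P l t := by
  simp only [h.spectral t ht, Complex.coe_smul]

lemma continuousOn_H₀ (h : IsAdiabatic T H₀ E P) : ContinuousOn H₀ (Icc 0 T) := by
  refine ContinuousOn.congr (f := fun t => ∑ l, E l t • P l t) ?_ fun t ht => h.spectral_real ht
  exact continuousOn_finsetSum _ fun l _ =>
    (h.contDiff_E l).continuousOn.smul (h.contDiff_P l).continuousOn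

lemma isSelfAdjoint_H₀ (h : IsAdiabatic T H₀ E P) {t : ℝ} (ht : t ∈ Icc 0 T) :
    IsSelfAdjoint (H₀ t) := by
  rw [h.spectral_real ht]
  exact isSelfAdjoint_sum _ fun l _ => (IsSelfAdjoint.all (E l t)).smul (h.selfAdjoint l t ht)

lemma isSelfAdjoint_zeno (h : IsAdiabatic T H₀ E P) {G : ℝ → 𝓗 →L[ℂ] 𝓗} {t : ℝ}
    (ht : t ∈ Icc 0 T) (hG : IsSelfAdjoint (G t)) : IsSelfAdjoint (zeno P G t) := by
  refine isSelfAdjoint_sum _ fun l _ => ?_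
  have := (h.selfAdjoint l t ht).star_eq
  simp [IsSelfAdjoint, star_mul, this, hG.star_eq, mul_assoc]

lemma continuousOn_zeno (h : IsAdiabatic T H₀ E P) {G : ℝ → 𝓗 →L[ℂ] 𝓗}
    (hG : ContinuousOn G (Icc 0 T)) : ContinuousOn (zeno P G) (Icc 0 T) :=
  continuousOn_finsetSum _ fun l _ =>
    ((h.contDiff_P l).continuousOn.mul hG).mul (h.contDiff_P l).continuousOn

/-- The derivative of `∑ₖₗ wₖₗ Pₖ X Pₗ` along the adiabatic projections. -/
lemma hasDerivWithinAt_blockSum (h : IsAdiabatic T H₀ E P) (hT : 0 < T) {t : ℝ}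
    (ht : t ∈ Icc 0 T) {w : Fin m → Fin m → ℝ → ℝ} {w' : Fin m → Fin m → ℝ}
    (hw : ∀ k l, HasDerivWithinAt (w k l) (w' k l) (Icc 0 T) t) {X : ℝ → 𝓗 →L[ℂ] 𝓗}
    {X' : 𝓗 →L[ℂ] 𝓗} (hX : HasDerivWithinAt X X' (Icc 0 T) t) :
    HasDerivWithinAt (fun s => blockSum (fun l => P l s) (fun k l => w k l s) (X s))
      ((-Complex.I) • (connection T P t
            * blockSum (fun l => P l t) (fun k l => w k l t) (X t)
          - blockSum (fun l => P l t) (fun k l => w k l t) (X t) * connection T P t)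
        + blockSum (fun l => P l t) (fun k l => w k l t)
          (X' + Complex.I • (connection T P t * X t - X t * connection T P t))
        + blockSum (fun l => P l t) w' (X t)) (Icc 0 T) t := by
  have hd := HasDerivWithinAt.fun_sum (u := Finset.univ) fun k _ =>
    HasDerivWithinAt.fun_sum (u := Finset.univ) fun l _ =>
      (hw k l).smul (((h.hasDerivWithinAt_P k ht).mul hX).mul (h.hasDerivWithinAt_P l ht))
  refine hd.congr_deriv ?_
  simp only [blockSum, Finset.mul_sum, Finset.sum_mul, ← Finset.sum_sub_distrib, Finset.smul_sum,
    ← Finset.sum_add_distrib]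
  refine Finset.sum_congr rfl fun k _ => Finset.sum_congr rfl fun l _ => ?_
  -- With `Ṗ = -i [A, P]`, each block `Pₖ X Pₗ` is rotated as a whole by `A`; the commutator of `A`
  -- with `X` itself is then compensated inside the block.
  rw [← h.timeDeriv_P hT ht k, ← h.timeDeriv_P hT ht l]
  simp only [Pi.mul_apply, mul_smul_comm, smul_mul_assoc, mul_sub, sub_mul, mul_add, add_mul,
    mul_assoc, smul_add, smul_sub]
  module

end IsAdiabatic

/-! ### Comparison of the evolutions -/

/-- The comparison of two unitary evolutions by means of a dressing `C`. -/
lemma norm_timeOrderedExp_sub_le {T : ℝ} (hT : 0 ≤ T) {H K C C' : ℝ → 𝓗 →L[ℂ] 𝓗}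
    (hH : ContinuousOn H (Icc 0 T)) (hK : ContinuousOn K (Icc 0 T))
    (hHsa : ∀ t ∈ Icc 0 T, IsSelfAdjoint (H t)) (hKsa : ∀ t ∈ Icc 0 T, IsSelfAdjoint (K t))
    (hC : ∀ t ∈ Icc 0 T, HasDerivWithinAt C (C' t) (Icc 0 T) t) {y q : ℝ}
    (hy : ∀ t ∈ Icc 0 T, ‖C t - 1‖ ≤ y)
    (hq : ∀ t ∈ Icc 0 T, ‖Complex.I • (K t * C t - C t * H t) + C' t‖ ≤ q)
    {t : ℝ} (ht : t ∈ Icc 0 T) :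
    ‖timeOrderedExp H t - timeOrderedExp K t‖ ≤ 2 * y + q * T := by
  set U := timeOrderedExp H
  set V := timeOrderedExp K
  have h0 : (0 : ℝ) ∈ Icc 0 T := left_mem_Icc.2 hT
  have hU1 : ∀ s ∈ Icc 0 T, ‖U s‖ ≤ 1 := fun s hs =>
    norm_le_one_of_star_mul_self (star_mul_timeOrderedExp hT hH hHsa hs)
  have hV1 : ∀ s ∈ Icc 0 T, ‖V s‖ ≤ 1 := fun s hs =>
    norm_le_one_of_star_mul_self (star_mul_timeOrderedExp hT hK hKsa hs)
  have hbd : ∀ s ∈ Icc 0 T, ∀ B : 𝓗 →L[ℂ] 𝓗, ‖star (V s) * B * U s‖ ≤ ‖B‖ := by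
    intro s hs B
    calc ‖star (V s) * B * U s‖ ≤ ‖star (V s)‖ * ‖B‖ * ‖U s‖ :=
          (norm_mul_le _ _).trans (by gcongr; exact norm_mul_le _ _)
      _ ≤ 1 * ‖B‖ * 1 := by
          rw [norm_star]
          gcongr
          exacts [hV1 s hs, hU1 s hs]
      _ = ‖B‖ := by ring
  have hd : ∀ s ∈ Icc 0 T, HasDerivWithinAt (fun s => star (V s) * C s * U s)
      (star (V s) * (Complex.I • (K s * C s - C s * H s) + C' s) * U s) (Icc 0 T) s := by
    intro s hs
    have hU : HasDerivWithinAt U _ _ s := hasDerivWithinAt_timeOrderedExp hT hH hs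
    have hV : HasDerivWithinAt V _ _ s := hasDerivWithinAt_timeOrderedExp hT hK hs
    refine ((hV.star.mul (hC s hs)).mul hU).congr_deriv ?_
    simp only [Pi.mul_apply, star_smul, star_mul, star_neg, (hKsa s hs).star_eq,
      Complex.star_def, Complex.conj_I, neg_neg, mul_add, add_mul, smul_mul_assoc,
      mul_smul_comm, mul_sub, sub_mul, mul_assoc, smul_sub, neg_smul, mul_neg]
    module
  have hmv := (convex_Icc 0 T).norm_image_sub_le_of_norm_hasDerivWithin_le hd
    (fun s hs => (hbd s hs _).trans (hq s hs)) h0 ht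
  have hq0 : 0 ≤ q := (norm_nonneg _).trans (hq 0 h0)
  have hV0 : V 0 = 1 := timeOrderedExp_zero K
  have hU0 : U 0 = 1 := timeOrderedExp_zero H
  rw [hV0, hU0, star_one, one_mul, mul_one, sub_zero, Real.norm_of_nonneg ht.1] at hmv
  have hVV : V t * star (V t) = 1 := timeOrderedExp_mul_star hT hK hKsa ht
  -- Unitarity of `V` reduces the difference to `V⋆ U - 1`. Inserting `C` at times `t` and `0` costs
  -- `y` each, the origin of `2 * y`.
  have hUV : U t - V t = V t * ((star (V t) * C t * U t - C 0)
      - star (V t) * (C t - 1) * U t + (C 0 - 1)) := by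
    have : (star (V t) * C t * U t - C 0) - star (V t) * (C t - 1) * U t + (C 0 - 1)
        = star (V t) * U t - 1 := by noncomm_ring
    rw [this, mul_sub, ← mul_assoc, hVV, one_mul, mul_one]
  rw [hUV]
  calc _ ≤ ‖V t‖ * ‖(star (V t) * C t * U t - C 0)
      - star (V t) * (C t - 1) * U t + (C 0 - 1)‖ := norm_mul_le _ _
    _ ≤ 1 * (‖star (V t) * C t * U t - C 0‖ + ‖star (V t) * (C t - 1) * U t‖ + ‖C 0 - 1‖) := by
        gcongr
        · exact hV1 t ht
        · exact (norm_add_le _ _).trans (by gcongr; exact norm_sub_le _ _)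
    _ ≤ 1 * (q * T + y + y) := by
        gcongr
        · exact hmv.trans (by gcongr; exact ht.2)
        · exact (hbd t ht _).trans (hy t ht)
        · exact hy 0 h0
    _ = 2 * y + q * T := by ring

/-! ### The quantitative estimate with the dressing `1 + κ⁻¹ Y` -/

namespace IsAdiabatic

variable {m : ℕ} {T : ℝ} {H₀ : ℝ → 𝓗 →L[ℂ] 𝓗} {E : Fin m → ℝ → ℝ} {P : Fin m → ℝ → 𝓗 →L[ℂ] 𝓗}

lemma hasDerivWithinAt_inv_gap (h : IsAdiabatic T H₀ E P) {t : ℝ} (ht : t ∈ Icc 0 T)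
    (k l : Fin m) : HasDerivWithinAt (fun s => (E k s - E l s)⁻¹)
      (-timeDeriv T (fun s => E k s - E l s) t / (E k t - E l t) ^ 2) (Icc 0 T) t := by
  -- For `k = l` both the weight and the stated derivative are identically zero, by division by
  -- zero.
  by_cases hkl : k = l
  · subst hkl
    simpa using hasDerivWithinAt_const t (Icc 0 T) (0 : ℝ)
  · exact ((((h.differentiableOn_E k).sub (h.differentiableOn_E l)) t ht).hasDerivWithinAt).inv
      (abs_pos.1 (h.noCrossing k l hkl t ht))

/-- The quantitative adiabatic estimate, in terms of real bounds for all the quantities. -/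
theorem norm_evolution_sub_le (h : IsAdiabatic T H₀ E P) (hT : 0 < T) {G : ℝ → 𝓗 →L[ℂ] 𝓗}
    (hGsa : ∀ t ∈ Icc 0 T, IsSelfAdjoint (G t)) (hGd : DifferentiableOn ℝ G (Icc 0 T))
    {κ η η' a a' g g' : ℝ} (hκ : 0 < κ) (hη : 0 < η) (hη' : 0 ≤ η')
    (hgap : ∀ k l, k ≠ l → ∀ t ∈ Icc 0 T, η ≤ |E k t - E l t|)
    (hslope : ∀ k l, k ≠ l → ∀ t ∈ Icc 0 T, |timeDeriv T (fun s => E k s - E l s) t| ≤ η')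
    (ha : ∀ t ∈ Icc 0 T, ‖connection T P t‖ ≤ a)
    (ha' : ∀ t ∈ Icc 0 T, ‖timeDeriv T (connection T P) t‖ ≤ a')
    (hg : ∀ t ∈ Icc 0 T, ‖G t‖ ≤ g) (hg' : ∀ t ∈ Icc 0 T, ‖timeDeriv T G t‖ ≤ g')
    {t : ℝ} (ht : t ∈ Icc 0 T) :
    ‖timeOrderedExp (fun s => (κ : ℂ) • H₀ s + G s) t - adiabaticEvolution T H₀ P G κ t‖
      ≤ Real.sqrt m / (κ * η) * ((2 + T * (a + 2 * g) + η' / η * T) * (a + g)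
        + T * (a' + g' + 2 * a * g)) := by
  have h0 : (0 : ℝ) ∈ Icc 0 T := left_mem_Icc.2 hT.le
  have ha0 : 0 ≤ a := (norm_nonneg _).trans (ha 0 h0)
  have hg0 : 0 ≤ g := (norm_nonneg _).trans (hg 0 h0)
  have hAc := h.contDiffOn_connection hT
  set A := connection T P with hA
  set X : ℝ → 𝓗 →L[ℂ] 𝓗 := fun s => G s - A s with hX
  set w : Fin m → Fin m → ℝ → ℝ := fun k l s => (E k s - E l s)⁻¹ with hw
  set w' : Fin m → Fin m → ℝ → ℝ := fun k l s =>
    -timeDeriv T (fun s => E k s - E l s) s / (E k s - E l s) ^ 2 with hw'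
  set R : (Fin m → Fin m → ℝ → ℝ) → ℝ → (𝓗 →L[ℂ] 𝓗) → 𝓗 →L[ℂ] 𝓗 := fun w s B =>
    blockSum (fun l => P l s) (fun k l => w k l s) B with hR
  set Y : ℝ → 𝓗 →L[ℂ] 𝓗 := fun s => R w s (X s) with hY
  set Y' : ℝ → 𝓗 →L[ℂ] 𝓗 := fun s => (-Complex.I) • (A s * Y s - Y s * A s)
    + R w s (timeDeriv T G s - timeDeriv T A s + Complex.I • (A s * X s - X s * A s))
    + R w' s (X s) with hY'
  have hwb : ∀ s ∈ Icc 0 T, ∀ k l, |w k l s| ≤ η⁻¹ := by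
    intro s hs k l
    by_cases hkl : k = l
    · simp [hw, hkl, hη.le]
    · simp only [hw, abs_inv]
      exact inv_anti₀ hη (hgap k l hkl s hs)
  have hwb' : ∀ s ∈ Icc 0 T, ∀ k l, |w' k l s| ≤ η' / η ^ 2 := by
    intro s hs k l
    by_cases hkl : k = l
    · simp only [hw', hkl, sub_self]
      simp only [ne_eq, OfNat.ofNat_ne_zero, not_false_eq_true, zero_pow, div_zero, abs_zero]
      positivity
    · simp only [hw', abs_div, abs_neg, abs_pow]
      gcongr
      exacts [hslope k l hkl s hs, hgap k l hkl s hs]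
  have hRw : ∀ s ∈ Icc 0 T, ∀ B, ‖R w s B‖ ≤ Real.sqrt m * η⁻¹ * ‖B‖ := fun s hs B =>
    (h.isResolution hs).norm_blockSum_le (by positivity) (hwb s hs) B
  have hRw' : ∀ s ∈ Icc 0 T, ∀ B, ‖R w' s B‖ ≤ Real.sqrt m * (η' / η ^ 2) * ‖B‖ := fun s hs B =>
    (h.isResolution hs).norm_blockSum_le (by positivity) (hwb' s hs) B
  have hXb : ∀ s ∈ Icc 0 T, ‖X s‖ ≤ a + g := fun s hs =>
    (norm_sub_le _ _).trans (by linarith [ha s hs, hg s hs])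
  have hYb : ∀ s ∈ Icc 0 T, ‖Y s‖ ≤ Real.sqrt m * η⁻¹ * (a + g) := fun s hs =>
    (hRw s hs _).trans (by gcongr; exact hXb s hs)
  have hYd : ∀ s ∈ Icc 0 T, HasDerivWithinAt Y (Y' s) (Icc 0 T) s := by
    intro s hs
    have hGs : HasDerivWithinAt G (timeDeriv T G s) (Icc 0 T) s := (hGd s hs).hasDerivWithinAt
    have hAs : HasDerivWithinAt A (timeDeriv T A s) (Icc 0 T) s :=
      (hAc.differentiableOn (by norm_num) s hs).hasDerivWithinAt
    exact h.hasDerivWithinAt_blockSum hT hs (h.hasDerivWithinAt_inv_gap hs) (hGs.sub hAs)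
  have hcomm : ∀ s ∈ Icc 0 T, H₀ s * Y s - Y s * H₀ s = G s - A s - zeno P G s := by
    intro s hs
    have := (h.isResolution hs).commutator_blockSum (e := fun l => E l s)
      (fun k l hkl => sub_ne_zero.1 (abs_pos.1 (h.noCrossing k l hkl s hs))) (X s)
    rw [h.spectral_real hs]
    refine this.trans ?_
    simp only [hX, mul_sub, sub_mul, Finset.sum_sub_distrib, h.diag_connection hT hs, hA, zeno]
    simp
  have hQ : ∀ s ∈ Icc 0 T,
      ‖Complex.I • (((κ : ℂ) • H₀ s + zeno P G s + A s) * (1 + κ⁻¹ • Y s)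
          - (1 + κ⁻¹ • Y s) * ((κ : ℂ) • H₀ s + G s)) + κ⁻¹ • Y' s‖
        ≤ κ⁻¹ * (Real.sqrt m * η⁻¹ * ((a + 2 * g + η' / η) * (a + g)
          + (a' + g' + 2 * a * g))) := by
    intro s hs
    -- The zeroth order in `κ⁻¹` cancels through `[H₀, Y]`. At the next order the `-i [A, Y]` inside
    -- `Y'` absorbs `i A Y`, leaving `i Y A`, which joins `-i Y G` to form `-i Y X`.
    have hQe : Complex.I • (((κ : ℂ) • H₀ s + zeno P G s + A s) * (1 + κ⁻¹ • Y s)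
          - (1 + κ⁻¹ • Y s) * ((κ : ℂ) • H₀ s + G s)) + κ⁻¹ • Y' s
        = κ⁻¹ • (Complex.I • (zeno P G s * Y s) - Complex.I • (Y s * X s)
          + R w s (timeDeriv T G s - timeDeriv T A s + Complex.I • (A s * X s - X s * A s))
          + R w' s (X s)) := by
      have hc : κ⁻¹ • ((κ : ℂ) • (H₀ s * Y s) - (κ : ℂ) • (Y s * H₀ s))
          = G s - A s - zeno P G s := by
        rw [← hcomm s hs, Complex.coe_smul, Complex.coe_smul, ← smul_sub, smul_smul,
          inv_mul_cancel₀ hκ.ne', one_smul]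
      have hYX : Y s * X s = Y s * G s - Y s * A s := mul_sub _ _ _
      rw [hYX]
      simp only [hY']
      generalize R w s (timeDeriv T G s - timeDeriv T A s
        + Complex.I • (A s * X s - X s * A s)) = B₁
      generalize R w' s (X s) = B₂
      have : ((κ : ℂ) • H₀ s + zeno P G s + A s) * (1 + κ⁻¹ • Y s)
          - (1 + κ⁻¹ • Y s) * ((κ : ℂ) • H₀ s + G s)
          = κ⁻¹ • (zeno P G s * Y s + A s * Y s - Y s * G s) := by
        have e : ((κ : ℂ) • H₀ s + zeno P G s + A s) * (1 + κ⁻¹ • Y s)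
          - (1 + κ⁻¹ • Y s) * ((κ : ℂ) • H₀ s + G s)
          = κ⁻¹ • ((κ : ℂ) • (H₀ s * Y s) - (κ : ℂ) • (Y s * H₀ s))
            - (G s - A s - zeno P G s)
            + κ⁻¹ • (zeno P G s * Y s + A s * Y s - Y s * G s) := by
          simp only [mul_add, add_mul, mul_one, one_mul, smul_mul_assoc, mul_smul_comm]
          module
        rw [e, hc]
        abel
      rw [this]
      module
    -- Since `A` commutes with itself, this commutator contributes only `2 a g`, with no `a²` term.
    have hAX : A s * X s - X s * A s = A s * G s - G s * A s := by
      simp only [hX]; noncomm_ring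
    have hYs := hYb s hs
    have hXs := hXb s hs
    have hAs := ha s hs
    have hGs := hg s hs
    rw [hQe, norm_smul, Real.norm_of_nonneg (by positivity : 0 ≤ κ⁻¹)]
    gcongr
    have e1 : ‖Complex.I • (zeno P G s * Y s)‖ ≤ g * (Real.sqrt m * η⁻¹ * (a + g)) := by
      rw [norm_smul, Complex.norm_I, one_mul]
      refine (norm_mul_le _ _).trans ?_
      gcongr
      exact ((h.isResolution hs).norm_zeno_le (G s)).trans hGs
    have e2 : ‖Complex.I • (Y s * X s)‖ ≤ Real.sqrt m * η⁻¹ * (a + g) * (a + g) := by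
      rw [norm_smul, Complex.norm_I, one_mul]
      refine (norm_mul_le _ _).trans ?_
      gcongr
    have e3 : ‖R w s (timeDeriv T G s - timeDeriv T A s
        + Complex.I • (A s * X s - X s * A s))‖
        ≤ Real.sqrt m * η⁻¹ * (g' + a' + (a * g + g * a)) := by
      refine (hRw s hs _).trans ?_
      gcongr
      refine (norm_add_le _ _).trans (add_le_add ((norm_sub_le _ _).trans
        (add_le_add (hg' s hs) (ha' s hs))) ?_)
      rw [hAX, norm_smul, Complex.norm_I, one_mul]
      refine (norm_sub_le _ _).trans (add_le_add ((norm_mul_le _ _).trans ?_)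
        ((norm_mul_le _ _).trans ?_)) <;> gcongr
    have e4 : ‖R w' s (X s)‖ ≤ Real.sqrt m * (η' / η ^ 2) * (a + g) :=
      (hRw' s hs _).trans (by gcongr)
    calc _ ≤ ‖Complex.I • (zeno P G s * Y s)‖ + ‖Complex.I • (Y s * X s)‖ + _ + _ :=
          (norm_add_le _ _).trans (add_le_add_left ((norm_add_le _ _).trans
            (add_le_add_left (norm_sub_le _ _) _)) _)
      _ ≤ _ := add_le_add (add_le_add (add_le_add e1 e2) e3) e4
      _ = _ := by field_simp; ring
  have hGc := hGd.continuousOn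
  have hH₀c : ContinuousOn (fun s => (κ : ℂ) • H₀ s) (Icc 0 T) := h.continuousOn_H₀.const_smul (κ : ℂ)
  have hH₀sa : ∀ s ∈ Icc 0 T, IsSelfAdjoint ((κ : ℂ) • H₀ s) := fun s hs => by
    rw [Complex.coe_smul]
    exact (IsSelfAdjoint.all κ).smul (h.isSelfAdjoint_H₀ hs)
  refine (norm_timeOrderedExp_sub_le (C := fun s => 1 + κ⁻¹ • Y s) (C' := fun s => κ⁻¹ • Y' s)
    hT.le (hH₀c.add hGc) ((hH₀c.add (h.continuousOn_zeno hGc)).add hAc.continuousOn)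
    (fun s hs => (hH₀sa s hs).add (hGsa s hs))
    (fun s hs => ((hH₀sa s hs).add (h.isSelfAdjoint_zeno hs (hGsa s hs))).add
      (h.isSelfAdjoint_connection hT hs))
    (fun s hs => ((hYd s hs).const_smul κ⁻¹).const_add 1)
    (y := κ⁻¹ * (Real.sqrt m * η⁻¹ * (a + g))) (fun s hs => ?_) hQ ht).trans (le_of_eq ?_)
  · rw [add_sub_cancel_left, norm_smul, Real.norm_of_nonneg (by positivity : 0 ≤ κ⁻¹)]
    gcongr
    exact hYb s hs
  · field_simp
    ring

end IsAdiabatic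

/-! ### Finiteness of the constants -/

section SupNorm

variable {X : Type*} [NormedAddCommGroup X] {T : ℝ} {F : ℝ → X}

lemma norm_le_of_supNorm_eq {c : NNReal} (hc : supNorm T F = c) {t : ℝ} (ht : t ∈ Icc 0 T) :
    ‖F t‖ ≤ c := by
  have h : ‖F t‖ₑ ≤ supNorm T F := le_iSup₂ (f := fun s (_ : s ∈ Icc 0 T) => ‖F s‖ₑ) t ht
  rw [hc] at h
  exact_mod_cast enorm_le_coe.1 h

lemma supNorm_ne_top (hF : ContinuousOn F (Icc 0 T)) : supNorm T F ≠ ⊤ := by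
  obtain ⟨M, hM⟩ := isCompact_Icc.exists_bound_of_continuousOn hF
  refine ne_top_of_le_ne_top ENNReal.ofReal_ne_top (b := ENNReal.ofReal M) (iSup₂_le fun s hs => ?_)
  rw [← ofReal_norm]
  exact ENNReal.ofReal_le_ofReal (hM s hs)

end SupNorm

lemma minGap_le {m : ℕ} {T : ℝ} {E : Fin m → ℝ → ℝ} {k l : Fin m} (hkl : k ≠ l)
    {t : ℝ} (ht : t ∈ Icc 0 T) :
    minGap T E ≤ ‖E k t - E l t‖ₑ :=
  (iInf_le _ k).trans <| (iInf_le _ l).trans <| (iInf_le _ hkl).trans (iInf₂_le t ht)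

lemma supNorm_le_maxSlope {m : ℕ} {T : ℝ} {E : Fin m → ℝ → ℝ} {k l : Fin m} (hkl : k ≠ l) :
    supNorm T (timeDeriv T (fun t => E k t - E l t)) ≤ maxSlope T E :=
  le_iSup_of_le k <| le_iSup_of_le l <| le_iSup_of_le hkl le_rfl

namespace IsAdiabatic

variable {m : ℕ} {T : ℝ} {H₀ : ℝ → 𝓗 →L[ℂ] 𝓗} {E : Fin m → ℝ → ℝ} {P : Fin m → ℝ → 𝓗 →L[ℂ] 𝓗}

/-- There are finitely many pairs of levels, and each gap is continuous and positive on a compact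
interval, so the infimum is attained at a positive value or is `∞`. -/
lemma minGap_ne_zero (h : IsAdiabatic T H₀ E P) (hT : 0 < T) : minGap T E ≠ 0 := by
  rcases isEmpty_or_nonempty (Fin m) with hm | hm
  · simp only [minGap, iInf_of_empty]
    exact ENNReal.top_ne_zero
  · rw [minGap]
    obtain ⟨k, hk⟩ := exists_eq_ciInf_of_finite (f := fun k : Fin m =>
      ⨅ (l : Fin m) (_ : k ≠ l), ⨅ t ∈ Icc (0 : ℝ) T, ‖E k t - E l t‖ₑ)
    obtain ⟨l, hl⟩ := exists_eq_ciInf_of_finite (f := fun l : Fin m =>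
      ⨅ (_ : k ≠ l), ⨅ t ∈ Icc (0 : ℝ) T, ‖E k t - E l t‖ₑ)
    rw [← hk, ← hl]
    by_cases hkl : k = l
    · simp [hkl]
    · obtain ⟨s, hs, hmin⟩ := isCompact_Icc.exists_isMinOn (nonempty_Icc.2 hT.le)
        ((h.contDiff_E k).continuousOn.sub (h.contDiff_E l).continuousOn).norm
      have hpos : ‖E k s - E l s‖ₑ ≠ 0 :=
        enorm_ne_zero.2 (abs_pos.1 (h.noCrossing k l hkl s hs))
      rw [iInf_pos hkl]
      refine (lt_of_lt_of_le (pos_iff_ne_zero.2 hpos) (le_iInf₂ fun t ht => ?_)).ne'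
      rw [← ofReal_norm, ← ofReal_norm]
      exact ENNReal.ofReal_le_ofReal (hmin ht)

lemma maxSlope_ne_top (h : IsAdiabatic T H₀ E P) (hT : 0 < T) : maxSlope T E ≠ ⊤ := by
  rcases isEmpty_or_nonempty (Fin m) with hm | hm
  · simp [maxSlope]
  · rw [maxSlope]
    obtain ⟨k, hk⟩ := exists_eq_ciSup_of_finite (f := fun k : Fin m =>
      ⨆ (l : Fin m) (_ : k ≠ l), supNorm T (timeDeriv T (fun t => E k t - E l t)))
    obtain ⟨l, hl⟩ := exists_eq_ciSup_of_finite (f := fun l : Fin m =>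
      ⨆ (_ : k ≠ l), supNorm T (timeDeriv T (fun t => E k t - E l t)))
    rw [← hk, ← hl]
    refine ne_top_of_le_ne_top (supNorm_ne_top ?_) (iSup_le fun _ => le_rfl)
    exact ((h.contDiff_E k).sub (h.contDiff_E l)).continuousOn_derivWithin
      (uniqueDiffOn_Icc hT) le_rfl

lemma supNorm_connection_ne_top (h : IsAdiabatic T H₀ E P) (hT : 0 < T) :
    supNorm T (connection T P) ≠ ⊤ :=
  supNorm_ne_top (h.contDiffOn_connection hT).continuousOn

lemma supNorm_timeDeriv_connection_ne_top (h : IsAdiabatic T H₀ E P) (hT : 0 < T) :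
    supNorm T (timeDeriv T (connection T P)) ≠ ⊤ :=
  supNorm_ne_top ((h.contDiffOn_connection hT).continuousOn_derivWithin
    (uniqueDiffOn_Icc hT) le_rfl)

/-! ### The error bound -/

/-- With a single level, the two evolutions coincide. -/
lemma evolution_eq_of_subsingleton [Subsingleton (Fin m)] (h : IsAdiabatic T H₀ E P)
    (hT : 0 < T) (G : ℝ → 𝓗 →L[ℂ] 𝓗) (κ : ℝ) {t : ℝ} (ht : t ∈ Icc 0 T) :
    timeOrderedExp (fun s => (κ : ℂ) • H₀ s + G s) t = adiabaticEvolution T H₀ P G κ t := by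
  refine timeOrderedExp_congr (fun s hs => ?_) ht
  have hdiag : ∀ B : 𝓗 →L[ℂ] 𝓗, ∑ l, P l s * B * P l s = B := by
    intro B
    conv_rhs => rw [← (h.isResolution hs).sum_blocks B]
    exact Finset.sum_congr rfl fun k _ =>
      (Fintype.sum_subsingleton (fun l => P k s * B * P l s) k).symm
  have hA : connection T P s = 0 := by
    rw [← hdiag (connection T P s)]
    exact Finset.sum_eq_zero fun l _ => h.diag_connection hT hs l
  simp only [zeno, hdiag, hA, add_zero]

theorem enorm_evolution_sub_le (h : IsAdiabatic T H₀ E P) (hT : 0 < T) {G : ℝ → 𝓗 →L[ℂ] 𝓗}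
    (hGsa : ∀ t ∈ Icc 0 T, IsSelfAdjoint (G t)) (hGd : DifferentiableOn ℝ G (Icc 0 T))
    {κ : ℝ} (hκ : 0 < κ) {t : ℝ} (ht : t ∈ Icc 0 T) :
    ‖timeOrderedExp (fun s => (κ : ℂ) • H₀ s + G s) t - adiabaticEvolution T H₀ P G κ t‖ₑ
      ≤ errorBound T E P G κ := by
  rcases subsingleton_or_nontrivial (Fin m) with hm | hm
  · rw [h.evolution_eq_of_subsingleton hT G κ ht, sub_self, enorm_zero]
    exact zero_le
  obtain ⟨k₀, l₀, hkl₀⟩ := exists_pair_ne (Fin m)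
  have hm0 : 0 < Real.sqrt m := Real.sqrt_pos.2 (Nat.cast_pos.2 k₀.pos)
  have hN0 := h.minGap_ne_zero hT
  have hNt : minGap T E ≠ ⊤ :=
    ne_top_of_le_ne_top enorm_ne_top (minGap_le hkl₀ (left_mem_Icc.2 hT.le))
  -- `Ġ` is the only quantity that may be unbounded; then the bound is `∞`, because its prefactor is
  -- nonzero once there are two levels.
  by_cases hGt : supNorm T (timeDeriv T G) = ⊤
  · refine le_top.trans (le_of_eq ?_)
    have hT0 : ENNReal.ofReal T ≠ 0 := (ENNReal.ofReal_pos.2 hT).ne'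
    have h1 : ENNReal.ofReal (Real.sqrt m) / (ENNReal.ofReal κ * minGap T E) ≠ 0 :=
      (ENNReal.div_pos (ENNReal.ofReal_pos.2 hm0).ne'
        (ENNReal.mul_ne_top ENNReal.ofReal_ne_top hNt)).ne'
    rw [errorBound, hGt]
    simp only [add_top, top_add, ENNReal.mul_top hT0]
    rw [ENNReal.mul_top]
    exact mul_ne_zero h1 (by simp)
  have hfin : ∀ x : ℝ≥0∞, x ≠ ⊤ → ∃ c : NNReal, (c : ℝ≥0∞) = x := fun _ hx =>
    ⟨_, ENNReal.coe_toNNReal hx⟩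
  obtain ⟨n, hn⟩ := hfin _ hNt
  obtain ⟨n', hn'⟩ := hfin _ (h.maxSlope_ne_top hT)
  obtain ⟨a, ha⟩ := hfin _ (h.supNorm_connection_ne_top hT)
  obtain ⟨a', ha'⟩ := hfin _ (h.supNorm_timeDeriv_connection_ne_top hT)
  obtain ⟨g, hg⟩ := hfin _ (supNorm_ne_top hGd.continuousOn)
  obtain ⟨g', hg'⟩ := hfin _ hGt
  have hn0 : n ≠ 0 := by rintro rfl; exact hN0 hn.symm
  have hnpos : (0 : ℝ) < n := NNReal.coe_pos.2 (pos_iff_ne_zero.2 hn0)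
  have key := h.norm_evolution_sub_le hT hGsa hGd hκ hnpos n'.coe_nonneg
    (fun k l hkl s hs => by
      have := minGap_le (E := E) hkl hs
      rw [← hn] at this
      exact_mod_cast (ENNReal.coe_le_coe.1 this : n ≤ ‖E k s - E l s‖₊))
    (fun k l hkl s hs => by
      have h1 : ‖timeDeriv T (fun s => E k s - E l s) s‖ₑ ≤ n' := by
        rw [hn']
        exact (le_iSup₂ (f := fun s (_ : s ∈ Icc 0 T) =>
          ‖timeDeriv T (fun s => E k s - E l s) s‖ₑ) s hs).trans (supNorm_le_maxSlope hkl)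
      exact_mod_cast enorm_le_coe.1 h1)
    (fun s hs => norm_le_of_supNorm_eq ha.symm hs) (fun s hs => norm_le_of_supNorm_eq ha'.symm hs)
    (fun s hs => norm_le_of_supNorm_eq hg.symm hs) (fun s hs => norm_le_of_supNorm_eq hg'.symm hs)
    ht
  lift T to NNReal using hT.le
  lift κ to NNReal using hκ.le
  have hκ0 : κ ≠ 0 := by rintro rfl; simp at hκ
  have hB : errorBound T E P G κ = ((Real.sqrt m).toNNReal / (κ * n) * (1 + T * a + 2 * T * g)
      * ((2 + n' / n * T) * (a + g) + T * (a' + g' + 2 * a * g)) : NNReal) := by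
    rw [errorBound, ← hn, ← hn', ← ha, ← ha', ← hg, ← hg']
    push_cast [ENNReal.coe_div hn0, ENNReal.coe_div (mul_ne_zero hκ0 hn0)]
    simp [ENNReal.ofReal]
  rw [hB]
  refine enorm_le_coe.2 (NNReal.coe_le_coe.1 (key.trans ?_))
  push_cast
  rw [Real.coe_toNNReal _ hm0.le, mul_assoc (_ / _)]
  gcongr
  -- The real estimate has `p1` added inside the bracket, whereas the stated bound multiplies the
  -- bracket by `1 + p1`. The slack is exactly the two products of nonnegative terms used below.
  have p1 : 0 ≤ (T : ℝ) * (a + 2 * g) := by positivity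
  have p2 : 0 ≤ (n' : ℝ) / n * T * (a + g) + T * (a' + g' + 2 * a * g) := by positivity
  have p3 : 0 ≤ (a : ℝ) + g := by positivity
  linear_combination mul_nonneg p1 p2 + mul_nonneg p1 p3

/-- Splitting `κ = √κ · √κ` gives one `√κ` to each of the two factors of the bound. Both are affine
in `‖G‖` and `‖Ġ‖`, so each quotient tends to `0`. Two levels keep the gap finite, as the
manipulation of inverses in `ℝ≥0∞` requires. -/
theorem tendsto_errorBound [Nontrivial (Fin m)] (h : IsAdiabatic T H₀ E P) (hT : 0 < T)
    {G : ℝ → ℝ → 𝓗 →L[ℂ] 𝓗}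
    (hg : Filter.Tendsto (fun κ : ℝ => supNorm T (G κ) / ENNReal.ofReal (Real.sqrt κ))
      Filter.atTop (nhds 0))
    (hg' : Filter.Tendsto (fun κ : ℝ => supNorm T (timeDeriv T (G κ))
      / ENNReal.ofReal (Real.sqrt κ)) Filter.atTop (nhds 0)) :
    Filter.Tendsto (fun κ => errorBound T E P (G κ) κ) Filter.atTop (nhds 0) := by
  obtain ⟨k₀, l₀, hkl₀⟩ := exists_pair_ne (Fin m)
  have hN0 := h.minGap_ne_zero hT
  have hNt : minGap T E ≠ ⊤ :=
    ne_top_of_le_ne_top enorm_ne_top (minGap_le hkl₀ (left_mem_Icc.2 hT.le))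
  have ha := h.supNorm_connection_ne_top hT
  have ha' := h.supNorm_timeDeriv_connection_ne_top hT
  have hN' := h.maxSlope_ne_top hT
  have hr : Filter.Tendsto (fun κ : ℝ => ENNReal.ofReal (Real.sqrt κ)) Filter.atTop (nhds ⊤) :=
    ENNReal.tendsto_ofReal_atTop.comp Real.tendsto_sqrt_atTop
  have hconst : ∀ c : ℝ≥0∞, c ≠ ⊤ → Filter.Tendsto
      (fun κ : ℝ => c / ENNReal.ofReal (Real.sqrt κ)) Filter.atTop (nhds 0) := by
    intro c hc
    simpa using ENNReal.Tendsto.const_div hr (Or.inr hc)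
  have hmul : ∀ (c : ℝ≥0∞) (f : ℝ → ℝ≥0∞), c ≠ ⊤ → Filter.Tendsto f Filter.atTop (nhds 0) →
      Filter.Tendsto (fun κ => c * f κ) Filter.atTop (nhds 0) := by
    intro c f hc hf
    simpa using ENNReal.Tendsto.const_mul hf (Or.inr hc)
  have hC1 : 1 + ENNReal.ofReal T * supNorm T (connection T P) ≠ ⊤ := by finiteness
  have hC2 : 2 * ENNReal.ofReal T ≠ ⊤ := by finiteness
  have hC3 : 2 + maxSlope T E / minGap T E * ENNReal.ofReal T ≠ ⊤ := by
    have := ENNReal.div_ne_top hN' hN0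
    finiteness
  have hC4 : 2 * supNorm T (connection T P) ≠ ⊤ := by finiteness
  have hC5 : ENNReal.ofReal (Real.sqrt m) / minGap T E ≠ ⊤ :=
    ENNReal.div_ne_top ENNReal.ofReal_ne_top hN0
  have hF1 := (hconst _ hC1).add (hmul _ _ hC2 hg)
  have hF2 := (hmul _ _ hC3 ((hconst _ ha).add hg |>.trans (by simp))).add
    (hmul _ _ (ENNReal.ofReal_ne_top (r := T)) ((((hconst _ ha').add hg').add (hmul _ _ hC4 hg)).trans
      (by simp)))
  rw [add_zero] at hF1 hF2
  have hF := hmul _ _ hC5 ((ENNReal.Tendsto.mul hF1 (by simp) hF2 (by simp)).trans (by simp))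
  refine hF.congr' ?_
  filter_upwards [Filter.eventually_gt_atTop 0] with κ hκ
  have hr0 : ENNReal.ofReal (Real.sqrt κ) ≠ 0 := (ENNReal.ofReal_pos.2 (Real.sqrt_pos.2 hκ)).ne'
  have hκr : ENNReal.ofReal κ = ENNReal.ofReal (Real.sqrt κ) * ENNReal.ofReal (Real.sqrt κ) := by
    rw [← ENNReal.ofReal_mul (Real.sqrt_nonneg κ), Real.mul_self_sqrt hκ.le]
  rw [errorBound, hκr]
  have hinv : (ENNReal.ofReal (Real.sqrt κ) * ENNReal.ofReal (Real.sqrt κ) * minGap T E)⁻¹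
      = (ENNReal.ofReal (Real.sqrt κ))⁻¹ * (ENNReal.ofReal (Real.sqrt κ))⁻¹ * (minGap T E)⁻¹ := by
    rw [ENNReal.mul_inv (Or.inr hNt) (Or.inr hN0),
      ENNReal.mul_inv (Or.inl hr0) (Or.inl ENNReal.ofReal_ne_top)]
  simp only [div_eq_mul_inv, hinv]
  ring

theorem tendstoUniformlyOn_evolution_sub (h : IsAdiabatic T H₀ E P) (hT : 0 < T)
    {G : ℝ → ℝ → 𝓗 →L[ℂ] 𝓗} (hGsa : ∀ κ, 0 < κ → ∀ t ∈ Icc 0 T, IsSelfAdjoint (G κ t))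
    (hGd : ∀ κ, 0 < κ → DifferentiableOn ℝ (G κ) (Icc 0 T))
    (hg : Filter.Tendsto (fun κ : ℝ => supNorm T (G κ) / ENNReal.ofReal (Real.sqrt κ))
      Filter.atTop (nhds 0))
    (hg' : Filter.Tendsto (fun κ : ℝ => supNorm T (timeDeriv T (G κ))
      / ENNReal.ofReal (Real.sqrt κ)) Filter.atTop (nhds 0)) :
    TendstoUniformlyOn (fun κ t : ℝ => timeOrderedExp (fun s => (κ : ℂ) • H₀ s + G κ s) t
      - adiabaticEvolution T H₀ P (G κ) κ t) (fun _ => 0) Filter.atTop (Icc 0 T) := by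
  rw [Metric.tendstoUniformlyOn_iff]
  intro ε hε
  rcases subsingleton_or_nontrivial (Fin m) with hm | hm
  · refine .of_forall fun κ t ht => ?_
    rwa [h.evolution_eq_of_subsingleton hT (G κ) κ ht, sub_self, dist_self]
  · filter_upwards [(h.tendsto_errorBound hT hg hg').eventually_lt_const (ENNReal.ofReal_pos.2 hε),
      Filter.eventually_gt_atTop 0] with κ hlt hκ t ht
    have := (h.enorm_evolution_sub_le hT (hGsa κ hκ) (hGd κ hκ) hκ ht).trans_lt hlt
    rw [← ofReal_norm, ENNReal.ofReal_lt_ofReal_iff hε] at this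
    rwa [dist_zero_left]

end IsAdiabatic

end GenAdiabatic

end

/-! ### The generalized adiabatic theorem and its strong-coupling case -/

theorem mainTheorem6 {𝓗 : Type*} [NormedAddCommGroup 𝓗] [InnerProductSpace ℂ 𝓗] [CompleteSpace 𝓗]
    {m : ℕ} (T : ℝ) (hT : 0 < T)
    (H₀ : ℝ → 𝓗 →L[ℂ] 𝓗) (E : Fin m → ℝ → ℝ) (P : Fin m → ℝ → 𝓗 →L[ℂ] 𝓗)
    (hH₀ : GenAdiabatic.IsAdiabatic T H₀ E P) :
    -- the generalized adiabatic theorem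
    (∀ H : ℝ → ℝ → 𝓗 →L[ℂ] 𝓗,
      (∀ κ : ℝ, 0 < κ → MeasureTheory.IntegrableOn (H κ) (Set.Icc 0 T)) →
      (∀ κ : ℝ, 0 < κ → ∀ t ∈ Set.Icc 0 T, IsSelfAdjoint (H κ t)) →
      (∀ t ∈ Set.Icc 0 T,
        Filter.Tendsto (fun κ : ℝ => (1 / κ : ℂ) • H κ t) Filter.atTop (nhds (H₀ t))) →
      (∀ κ : ℝ, 0 < κ → DifferentiableOn ℝ (GenAdiabatic.remainder H H₀ κ) (Set.Icc 0 T)) →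
      Filter.Tendsto (fun κ : ℝ => GenAdiabatic.supNorm T (GenAdiabatic.remainder H H₀ κ)
        / ENNReal.ofReal (Real.sqrt κ)) Filter.atTop (nhds 0) →
      Filter.Tendsto (fun κ : ℝ =>
        GenAdiabatic.supNorm T (GenAdiabatic.timeDeriv T (GenAdiabatic.remainder H H₀ κ))
          / ENNReal.ofReal (Real.sqrt κ)) Filter.atTop (nhds 0) →
      TendstoUniformlyOn
        (fun (κ t : ℝ) => GenAdiabatic.timeOrderedExp (H κ) t
          - GenAdiabatic.adiabaticEvolution T H₀ P (GenAdiabatic.remainder H H₀ κ) κ t)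
        (fun _ => 0) Filter.atTop (Set.Icc 0 T) ∧
      ∀ κ : ℝ, 0 < κ → ∀ t ∈ Set.Icc 0 T,
        ‖GenAdiabatic.timeOrderedExp (H κ) t
          - GenAdiabatic.adiabaticEvolution T H₀ P (GenAdiabatic.remainder H H₀ κ) κ t‖ₑ
          ≤ GenAdiabatic.errorBound T E P (GenAdiabatic.remainder H H₀ κ) κ) ∧
    -- the strong-coupling limit with time-dependent Hamiltonians
    (∀ H₁ : ℝ → 𝓗 →L[ℂ] 𝓗,
      (∀ t ∈ Set.Icc 0 T, IsSelfAdjoint (H₁ t)) →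
      DifferentiableOn ℝ H₁ (Set.Icc 0 T) →
      GenAdiabatic.supNorm T (GenAdiabatic.timeDeriv T H₁) < ⊤ →
      TendstoUniformlyOn
        (fun (κ t : ℝ) => GenAdiabatic.timeOrderedExp (fun s => (κ : ℂ) • H₀ s + H₁ s) t
          - GenAdiabatic.adiabaticEvolution T H₀ P H₁ κ t)
        (fun _ => 0) Filter.atTop (Set.Icc 0 T) ∧
      ∀ κ : ℝ, 0 < κ → ∀ t ∈ Set.Icc 0 T,
        ‖GenAdiabatic.timeOrderedExp (fun s => (κ : ℂ) • H₀ s + H₁ s) t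
          - GenAdiabatic.adiabaticEvolution T H₀ P H₁ κ t‖ₑ
          ≤ GenAdiabatic.errorBound T E P H₁ κ) := by
  refine ⟨fun H _ hsa _ hd hg hg' => ?_, fun H₁ hsa hd hd' => ?_⟩
  · have hH : ∀ κ : ℝ,
        H κ = fun s => (κ : ℂ) • H₀ s + GenAdiabatic.remainder H H₀ κ s := fun κ => by
      funext s
      simp [GenAdiabatic.remainder]
    have hGsa : ∀ κ : ℝ, 0 < κ → ∀ t ∈ Set.Icc 0 T,
        IsSelfAdjoint (GenAdiabatic.remainder H H₀ κ t) := fun κ hκ t ht => by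
      rw [GenAdiabatic.remainder, Complex.coe_smul]
      exact (hsa κ hκ t ht).sub ((IsSelfAdjoint.all κ).smul (hH₀.isSelfAdjoint_H₀ ht))
    refine ⟨?_, fun κ hκ t ht => ?_⟩
    · convert hH₀.tendstoUniformlyOn_evolution_sub hT hGsa hd hg hg' using 4 with κ t
      exact congrArg (GenAdiabatic.timeOrderedExp · t) (hH κ)
    · convert hH₀.enorm_evolution_sub_le hT (hGsa κ hκ) (hd κ hκ) hκ ht using 4
      exact hH κ
  · have hr : Filter.Tendsto (fun κ : ℝ => ENNReal.ofReal (Real.sqrt κ)) Filter.atTop (nhds ⊤) :=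
      ENNReal.tendsto_ofReal_atTop.comp Real.tendsto_sqrt_atTop
    refine ⟨hH₀.tendstoUniformlyOn_evolution_sub (G := fun _ => H₁) hT (fun _ _ => hsa)
      (fun _ _ => hd) ?_ ?_, fun κ hκ t ht => hH₀.enorm_evolution_sub_le hT hsa hd hκ ht⟩
    -- A fixed `H₁`, differentiable on a compact interval, has finite sup norm, and a finite
    -- constant is `o(√κ)`.
    · simpa using ENNReal.Tendsto.const_div hr
        (Or.inr (GenAdiabatic.supNorm_ne_top hd.continuousOn))
    · simpa using ENNReal.Tendsto.const_div hr (Or.inr hd'.ne)
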